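/- Let $\Delta=\{z\in\mathbb C:|z|<1\}$. A family of holomorphic functions on $\Delta$ is called normal if every sequence in it has a subsequence that converges uniformly on each compact subset of $\Delta$ either to a finite-valued function or to $\infty$. For a meromorphic function $f$ put $m(r,f)=\frac1{2\pi}\int_0^{2\pi}\log^+|f(re^{i\theta})|\,d\theta$, let $n(r,f)$ be the number of poles of $f$ in $|z|\le r$ counted with multiplicity, $N(r,f)=\int_0^r\frac{n(t,f)-n(0,f)}{t}\,dt+n(0,f)\log r$, and $T(r,f)=m(r,f)+N(r,f)$. Let $\mathcal F$ be a family of holomorphic functions on $\Delta$ which is not normal, and let $k\ge 1$ be a fixed integer. Then there is an $r_0\in(0,1)$ such that for every $\rho$ with $r_0<\rho<1$ there is an infinite subfamily $\mathcal F_1\subseteq\mathcal F$, consisting of functions that are not identically zero, for which the following two assertions hold. (i) There are real constants $A,B,C$ (depending on $\rho$, but not on $f$, $r$, $R$) such that $$m\left(r,\frac{f^{(k)}}{f}\right)<A+B\log^+T(R,f)+C\log\frac1{R-r}\qquad\text{for all } f\in\mathcal F_1 \text{ and all } r_0<r<R<\rho.$$ (ii) There are real constants $A,B,C$ (depending on $\rho$,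 but not on $f$, $r$, $R$) such that $$T(r,f^{(k)})\le A+B\,T(R,f)+C\log\frac1{R-r}\qquad\text{for all } f\in\mathcal F_1 \text{ and all } r_0<r<R<\rho.$$ -/

import Mathlib

namespace NormalFamilies

/-- Montel's definition of a normal family of holomorphic functions on `Ω`: every sequence in the
family has a subsequence that converges, uniformly on every compact subset of `Ω`, either to a
finite-valued limit function or to `∞`. -/
def IsNormalFamilyOn (F : Set (ℂ → ℂ)) (Ω : Set ℂ) : Prop :=
  ∀ u : ℕ → ℂ → ℂ, (∀ n, u n ∈ F) →
    ∃ φ : ℕ → ℕ, StrictMono φ ∧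
      ((∃ g : ℂ → ℂ, ∀ K : Set ℂ, K ⊆ Ω → IsCompact K →
          TendstoUniformlyOn (fun n => u (φ n)) g Filter.atTop K) ∨
        (∀ K : Set ℂ, K ⊆ Ω → IsCompact K →
          ∀ M : ℝ, ∀ᶠ n in Filter.atTop, ∀ z ∈ K, M < ‖u (φ n) z‖))

/-- The members of `F`, regarded as functions on `Ω` only, form an infinite set. -/
def InfiniteFamilyOn (F : Set (ℂ → ℂ)) (Ω : Set ℂ) : Prop :=
  ((fun f : ℂ → ℂ => Ω.domRestrict f) '' F).Infinite

/-- The proximity function `m(r, f) = (1 / 2π) ∫ log⁺ |f(r e^{iθ})| dθ` over `0 ≤ θ ≤ 2π`. -/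
noncomputable def m (r : ℝ) (f : ℂ → ℂ) : ℝ :=
  ValueDistribution.proximity f ⊤ r

/-- The number `n(r, f)` of poles of `f` in `|z| ≤ r`, counted with multiplicity. -/
noncomputable def n (r : ℝ) (f : ℂ → ℂ) : ℝ :=
  ∑ᶠ z : ℂ, (((MeromorphicOn.divisor f (Metric.closedBall 0 r) z)⁻ : ℤ) : ℝ)

/-- The integrated counting function
`N(r, f) = ∫₀ʳ (n(t, f) - n(0, f)) / t dt + n(0, f) log r`. -/
noncomputable def N (r : ℝ) (f : ℂ → ℂ) : ℝ :=
  (∫ t in (0 : ℝ)..r, (n t f - n 0 f) / t) + n 0 f * Real.log r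

/-- The Nevanlinna characteristic `T(r, f) = m(r, f) + N(r, f)`. -/
noncomputable def T (r : ℝ) (f : ℂ → ℂ) : ℝ :=
  m r f + N r f

end NormalFamilies

namespace NormalFamilies

section

open Filter Topology Metric Real ComplexConjugate

/-! Non-normality is used once. If for all s < 1 and c > 0 only finitely many members exceeded c
somewhere on |z| ≤ s, every sequence would have a subsequence that is constant on the unit disc or
tends to 0. So some s and c leave infinitely many members with |f(w)| > c at a point |w| ≤ s, which
may vary with f. The rest is a lemma on the logarithmic derivative, uniform over all such f; the
radius r₀ = (1 + s)/2 keeps w at a fixed distance from every circle used.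

The Poisson–Jensen formula at w turns the lower bound for log |f(w)| into bounds, affine in T(R, f),
for the mean of |log |f|| and for the number of zeros (`circleAverage_abs_log_le_and_card_le`). The
formula is not differentiated. Comparing its values at z and at nearby points gives |f| ≤ e |f(z)|
on the disc of radius 1/D about z, with D = Σ d_a/|z - a| + H, and Cauchy's estimate yields |f⁽ᵏ⁾/f|
≤ k! e Dᵏ at z for every k at once. The mean of log D over |z| = r is then bounded by concavity of
log, after passing to the integrable |z - a|^(-1/2). Assertion (ii) follows from f⁽ᵏ⁾ = (f⁽ᵏ⁾/f) f
and the monotonicity of r ↦ m(r, f). -/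

/-! ### A uniform lower bound from non-normality -/

/-- A family that is not normal contains infinitely many functions which exceed a fixed positive
bound somewhere on a fixed smaller closed disc. -/
theorem exists_infinite_subfamily_of_not_normal {F : Set (ℂ → ℂ)}
    (hF : ¬ IsNormalFamilyOn F (ball 0 1)) :
    ∃ s c : ℝ, 0 ≤ s ∧ s < 1 ∧ 0 < c ∧
      InfiniteFamilyOn {f ∈ F | ∃ z ∈ closedBall (0 : ℂ) s, c < ‖f z‖} (ball 0 1) := by
  by_contra! H
  refine hF fun u hu => ?_
  -- Either one restriction recurs infinitely often, giving a constant subsequence, or each occurs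
  -- finitely often, and then the whole sequence tends to 0.
  by_cases hx : ∃ x, {n | (ball (0 : ℂ) 1).domRestrict (u n) = x}.Infinite
  · obtain ⟨x, hx⟩ := hx
    obtain ⟨φ, hφ, hφx⟩ := extraction_of_frequently_atTop (Nat.frequently_atTop_iff_infinite.2 hx)
    refine ⟨φ, hφ, Or.inl ⟨u (φ 0), fun K hK _ => ?_⟩⟩
    rw [Metric.tendstoUniformlyOn_iff]
    intro ε hε
    refine Eventually.of_forall fun n z hz => ?_
    have := congrFun ((hφx n).trans (hφx 0).symm) ⟨z, hK hz⟩
    simp only [Set.domRestrict_apply] at this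
    rw [this, dist_self]
    exact hε
  · push Not at hx
    refine ⟨id, strictMono_id, Or.inl ⟨0, fun K hK hKc => ?_⟩⟩
    rw [Metric.tendstoUniformlyOn_iff]
    intro ε hε
    obtain ⟨s, hs, hKs⟩ := exists_lt_subset_ball hKc.isClosed hK
    -- The radius `s` may be negative when `K` is empty, hence `max s 0`.
    have hfin := H (max s 0) (ε / 2) (le_max_right _ _) (max_lt hs one_pos) (half_pos hε)
    rw [InfiniteFamilyOn, Set.not_infinite] at hfin
    have hpre := hfin.preimage' (f := fun n => (ball (0 : ℂ) 1).domRestrict (u n))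
      (fun b _ => (hx b))
    rw [← Nat.cofinite_eq_atTop]
    filter_upwards [hpre.eventually_cofinite_notMem] with n hn z hz
    by_contra hzn
    refine hn ⟨u n, ⟨hu n, z, ?_, ?_⟩, rfl⟩
    · exact closedBall_subset_closedBall (le_max_left _ _) (ball_subset_closedBall (hKs hz))
    · simp only [Pi.zero_apply, dist_zero_left, id, not_lt] at hzn
      linarith

/-! ### The characteristic without poles -/

theorem n_eq_zero_of_analyticOnNhd {f : ℂ → ℂ} {r : ℝ}
    (hf : AnalyticOnNhd ℂ f (closedBall 0 r)) : n r f = 0 := by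
  have h : ∀ z, ((MeromorphicOn.divisor f (closedBall 0 r) z)⁻ : ℤ) = 0 := fun z =>
    negPart_eq_zero.2 (MeromorphicOn.AnalyticOnNhd.divisor_nonneg hf z)
  simp [n, h]

theorem T_eq_circleAverage {f : ℂ → ℂ} {r : ℝ} (hr : 0 ≤ r)
    (hf : AnalyticOnNhd ℂ f (closedBall 0 r)) :
    T r f = circleAverage (fun z => posLog ‖f z‖) 0 r := by
  have h : ∀ t ≤ r, n t f = 0 := fun t ht =>
    n_eq_zero_of_analyticOnNhd (hf.mono (closedBall_subset_closedBall ht))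
  have hint : (∫ t in (0 : ℝ)..r, (n t f - n 0 f) / t) = 0 := by
    rw [intervalIntegral.integral_congr (g := fun _ => (0 : ℝ))]
    · simp
    · intro t ht
      rw [Set.uIcc_of_le hr] at ht
      simp [h t ht.2, h 0 hr]
  rw [T, N, hint, h 0 hr, m, ValueDistribution.proximity_top]
  simp

/-! ### Zeros and the Poisson–Jensen formula -/

/-- `f = ∏ (z - a) ^ d a * g` on the closed disc of radius `R`, where `g` has no zeros. -/
structure IsZeroFactorization (f : ℂ → ℂ) (R : ℝ) (s : Finset ℂ) (d : ℂ → ℕ) (g : ℂ → ℂ) :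
    Prop where
  analytic : AnalyticOnNhd ℂ g (closedBall 0 R)
  ne_zero : ∀ z ∈ closedBall (0 : ℂ) R, g z ≠ 0
  mem : ∀ a ∈ s, ‖a‖ ≤ R
  eq : ∀ z ∈ closedBall (0 : ℂ) R, f z = (∏ a ∈ s, (z - a) ^ d a) * g z

theorem exists_isZeroFactorization {f : ℂ → ℂ} {R : ℝ} (hR : 0 < R)
    (hf : AnalyticOnNhd ℂ f (closedBall 0 R)) {w : ℂ} (hw : w ∈ closedBall 0 R) (hfw : f w ≠ 0) :
    ∃ s d g, IsZeroFactorization f R s d g := by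
  have hmer := hf.meromorphicOn
  have hpre : IsPreconnected (closedBall (0 : ℂ) R) := (convex_closedBall _ _).isPreconnected
  have hord : ∀ u : closedBall (0 : ℂ) R, meromorphicOrderAt f u ≠ ⊤ := by
    refine (hmer.exists_meromorphicOrderAt_ne_top_iff_forall
      ⟨⟨w, hw⟩, hpre⟩).1 ⟨⟨w, hw⟩, ?_⟩
    rw [(hf w hw).meromorphicOrderAt_eq, (hf w hw).analyticOrderAt_eq_zero.2 hfw]
    simp
  have hfin := (MeromorphicOn.divisor f (closedBall 0 R)).finiteSupport (isCompact_closedBall 0 R)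
  obtain ⟨g, hg, hg0, heq⟩ := hmer.extract_zeros_poles hord hfin
  set D := MeromorphicOn.divisor f (closedBall 0 R) with hD
  have hD0 : ∀ z, 0 ≤ D z := fun z => MeromorphicOn.AnalyticOnNhd.divisor_nonneg hf z
  have hprod : ∀ z, (∏ᶠ u, (· - u) ^ D u : ℂ → ℂ) z = ∏ a ∈ hfin.toFinset, (z - a) ^ (D a).toNat := by
    intro z
    rw [Function.FactorizedRational.finprod_eq_fun hfin]
    dsimp only
    rw [finprod_eq_prod_of_mulSupport_subset (s := hfin.toFinset)]
    · refine Finset.prod_congr rfl fun a _ => ?_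
      conv_lhs => rw [← Int.toNat_of_nonneg (hD0 a)]
      rw [zpow_natCast]
    · intro a ha
      simp only [Set.Finite.coe_toFinset, Function.mem_support]
      rintro h
      simp [h] at ha
  refine ⟨hfin.toFinset, fun a => (D a).toNat, g, hg, fun z hz => hg0 ⟨z, hz⟩, ?_, ?_⟩
  · intro a ha
    have := D.supportWithinDomain (by simpa using ha)
    simpa using this
  · set P : ℂ → ℂ := fun z => (∏ a ∈ hfin.toFinset, (z - a) ^ (D a).toNat) * g z with hP
    have hPa : AnalyticOnNhd ℂ P (closedBall 0 R) := by
      intro z hz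
      refine AnalyticAt.mul ?_ (hg z hz)
      fun_prop
    have hev : ∀ᶠ z in codiscreteWithin (closedBall (0 : ℂ) R), f z = P z := by
      filter_upwards [heq] with z hz
      rw [hz, Pi.smul_apply', hprod]
      rfl
    have h0 : (0 : ℂ) ∈ closedBall (0 : ℂ) R := mem_closedBall_self hR.le
    -- Extracting the zeros gives equality only off a discrete set; the identity theorem extends it
    -- to the whole closed disc.
    refine hf.eqOn_of_preconnected_of_frequently_eq hPa hpre h0 ?_
    have hmem := mem_codiscreteWithin_iff_forall_mem_nhdsNE.1 hev 0 h0
    have hball : closedBall (0 : ℂ) R ∈ 𝓝[≠] (0 : ℂ) :=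
      mem_nhdsWithin_of_mem_nhds (closedBall_mem_nhds _ hR)
    refine Eventually.frequently ?_
    filter_upwards [hmem, hball] with z h1 h2
    rcases h1 with h1 | h1
    · exact h1
    · exact absurd h2 h1

/-- On |z| = R one has R|z - a| = |R² - ā z|. For |a| < R the right side has no zero in the closed
disc, so its logarithm is harmonic and the Poisson integral reproduces it. For |a| = R the two
expressions agree at `w` as well. -/
theorem circleAverage_poissonKernel_smul_log_norm_sub {R : ℝ} {a w : ℂ} (ha : ‖a‖ ≤ R)
    (hw : w ∈ ball (0 : ℂ) R) :
    circleAverage (poissonKernel 0 w • fun z => log ‖z - a‖) 0 R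
      = log (‖(R : ℂ) ^ 2 - conj a * w‖ / R) := by
  have hR : 0 < R := pos_of_mem_ball hw
  rcases ha.lt_or_eq with ha | ha
  · have hne : ∀ z ∈ closedBall (0 : ℂ) R, (R : ℂ) ^ 2 - conj a * z ≠ 0 := by
      intro z hz h
      rw [mem_closedBall_zero_iff] at hz
      have h1 : ‖(R : ℂ) ^ 2‖ = ‖conj a * z‖ := by rw [sub_eq_zero.1 h]
      rw [norm_pow, norm_mul, RCLike.norm_conj, Complex.norm_real, norm_of_nonneg hR.le] at h1
      nlinarith [norm_nonneg a, norm_nonneg z]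
    have hharm : InnerProductSpace.HarmonicOnNhd
        (fun z => log ‖((R : ℂ) ^ 2 - conj a * z) / R‖) (closedBall 0 R) := by
      intro z hz
      refine AnalyticAt.harmonicAt_log_norm (f := fun z => ((R : ℂ) ^ 2 - conj a * z) / R)
        (by fun_prop (disch := simpa using hR.ne')) ?_
      exact div_ne_zero (hne z hz) (by simpa using hR.ne')
    have := hharm.circleAverage_poissonKernel_smul hw
    rw [norm_div, Complex.norm_real, norm_of_nonneg hR.le] at this
    rw [← this]
    refine circleAverage_congr_sphere fun z hz => ?_
    rw [abs_of_pos hR] at hz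
    have h1 := Complex.norm_canonicalFactor_eval_circle_eq_one (w := a) (by simpa using ha) hz
    rw [Complex.canonicalFactor_apply, norm_div, norm_mul, Complex.norm_real,
      norm_of_nonneg hR.le] at h1
    have h2 : R * ‖z - a‖ ≠ 0 := by
      intro h
      rw [h] at h1
      simp at h1
    rw [div_eq_one_iff_eq h2] at h1
    simp only [Pi.smul_apply', norm_div, Complex.norm_real, norm_of_nonneg hR.le, h1]
    rw [mul_div_cancel_left₀ _ hR.ne']
  · have h := circleAverage_re_herglotzRieszKernel_mul_log₀ (ρ := a)
      (by simpa using ha) hw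
    rw [← poissonKernel_eq_re_herglotzRieszKernel] at h
    rw [h]
    have : (R : ℂ) ^ 2 - conj a * w = conj a * (a - w) := by
      rw [mul_sub, ← Complex.normSq_eq_conj_mul_self, Complex.normSq_eq_norm_sq, ha]
      push_cast; ring
    rw [this, norm_mul, RCLike.norm_conj, ha, mul_div_cancel_left₀ _ hR.ne', norm_sub_rev]

/-- Green's function of the disc of radius `R` with pole `a`. -/
noncomputable def green (R : ℝ) (w a : ℂ) : ℝ :=
  log (‖(R : ℂ) ^ 2 - conj a * w‖ / (R * ‖w - a‖))

theorem norm_sq_sub_conj_mul_pos {R : ℝ} {a w : ℂ} (ha : ‖a‖ ≤ R) (hw : ‖w‖ < R) :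
    R * (R - ‖w‖) ≤ ‖(R : ℂ) ^ 2 - conj a * w‖ := by
  have hR : 0 < R := (norm_nonneg w).trans_lt hw
  have h := norm_sub_norm_le ((R : ℂ) ^ 2) (conj a * w)
  rw [norm_pow, norm_mul, RCLike.norm_conj, Complex.norm_real, norm_of_nonneg hR.le] at h
  nlinarith [norm_nonneg w]

theorem circleIntegrable_poissonKernel_smul {R : ℝ} {w : ℂ} (hw : w ∈ ball (0 : ℂ) R) {u : ℂ → ℝ}
    (hu : CircleIntegrable u 0 R) : CircleIntegrable (poissonKernel 0 w • u) 0 R := by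
  refine hu.continuousOn_smul ?_
  rw [poissonKernel_eq_re_herglotzRieszKernel]
  exact Complex.continuous_re.comp_continuousOn (continuousOn_herglotzRieszKernel_sphere hw)

theorem IsZeroFactorization.apply_eq_zero_iff {f g : ℂ → ℂ} {R : ℝ} {s : Finset ℂ} {d : ℂ → ℕ}
    (h : IsZeroFactorization f R s d g) {z : ℂ} (hz : z ∈ closedBall (0 : ℂ) R) :
    f z = 0 ↔ ∃ a ∈ s, z = a ∧ d a ≠ 0 := by
  rw [h.eq z hz, mul_eq_zero, or_iff_left (h.ne_zero z hz), Finset.prod_eq_zero_iff]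
  simp only [pow_eq_zero_iff', sub_eq_zero]

theorem IsZeroFactorization.log_norm {f g : ℂ → ℂ} {R : ℝ} {s : Finset ℂ} {d : ℂ → ℕ}
    (h : IsZeroFactorization f R s d g) {z : ℂ} (hz : z ∈ closedBall (0 : ℂ) R) (hfz : f z ≠ 0) :
    log ‖f z‖ = ∑ a ∈ s, d a * log ‖z - a‖ + log ‖g z‖ := by
  have h0 := hfz
  rw [h.eq z hz] at h0
  have h1 := left_ne_zero_of_mul h0
  rw [h.eq z hz, norm_mul, log_mul (norm_ne_zero_iff.2 h1) (norm_ne_zero_iff.2 (h.ne_zero z hz)),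
    norm_prod, log_prod]
  · simp only [norm_pow, log_pow]
  · intro a ha
    rw [Finset.prod_ne_zero_iff] at h1
    exact norm_ne_zero_iff.2 (h1 a ha)

theorem circleIntegrable_log_norm_sub (a : ℂ) (R : ℝ) :
    CircleIntegrable (fun z => log ‖z - a‖) 0 R :=
  MeromorphicOn.circleIntegrable_log_norm (f := fun z => z - a) (by intro z _; fun_prop)

/-- The Poisson–Jensen formula, summed factor by factor. Zeros on the circle are allowed: their
Green's function vanishes. -/
theorem IsZeroFactorization.log_norm_eq_circleAverage_sub {f g : ℂ → ℂ} {R : ℝ} {s : Finset ℂ}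
    {d : ℂ → ℕ} (h : IsZeroFactorization f R s d g) {w : ℂ} (hw : w ∈ ball (0 : ℂ) R)
    (hfw : f w ≠ 0) :
    log ‖f w‖ = circleAverage (poissonKernel 0 w • fun z => log ‖f z‖) 0 R
      - ∑ a ∈ s, d a * green R w a := by
  have hR : 0 < R := pos_of_mem_ball hw
  have hgR : InnerProductSpace.HarmonicOnNhd (fun z => log ‖g z‖) (closedBall 0 R) :=
    fun z hz => (h.analytic z hz).harmonicAt_log_norm (h.ne_zero z hz)
  have hint : ∀ a ∈ s, CircleIntegrable
      (fun z => (d a : ℝ) • (poissonKernel 0 w • fun z => log ‖z - a‖) z) 0 R := fun a _ =>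
    (circleIntegrable_poissonKernel_smul hw (circleIntegrable_log_norm_sub a R)).const_smul
  have hintg : CircleIntegrable (poissonKernel 0 w • fun z => log ‖g z‖) 0 R := by
    refine circleIntegrable_poissonKernel_smul hw (MeromorphicOn.circleIntegrable_log_norm ?_)
    rw [abs_of_pos hR]
    exact (h.analytic.mono sphere_subset_closedBall).meromorphicOn
  have key : circleAverage (poissonKernel 0 w • fun z => log ‖f z‖) 0 R
      = ∑ a ∈ s, d a * log (‖(R : ℂ) ^ 2 - conj a * w‖ / R) + log ‖g w‖ := by
    have h1 : circleAverage (poissonKernel 0 w • fun z => log ‖f z‖) 0 R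
        = circleAverage (fun z => (∑ a ∈ s, (d a : ℝ) • (poissonKernel 0 w • fun z => log ‖z - a‖) z)
          + (poissonKernel 0 w • fun z => log ‖g z‖) z) 0 R := by
      refine circleAverage_congr_codiscreteWithin ?_ hR.ne'
      filter_upwards [compl_finite_mem_codiscreteWithin s.finite_toSet,
        self_mem_codiscreteWithin _] with z hz hzs
      rw [abs_of_pos hR] at hzs
      have hzc := sphere_subset_closedBall hzs
      have hfz : f z ≠ 0 := by
        rw [Ne, h.apply_eq_zero_iff hzc]
        rintro ⟨a, ha, rfl, -⟩
        exact hz ha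
      simp only [Pi.smul_apply', smul_eq_mul, h.log_norm hzc hfz, mul_add, Finset.mul_sum]
      congr 1
      exact Finset.sum_congr rfl fun a _ => by ring
    rw [h1, circleAverage_fun_add (CircleIntegrable.fun_sum s hint) hintg,
      circleAverage_fun_sum hint, hgR.circleAverage_poissonKernel_smul hw]
    congr 1
    refine Finset.sum_congr rfl fun a ha => ?_
    rw [circleAverage_fun_smul, circleAverage_poissonKernel_smul_log_norm_sub (h.mem a ha) hw,
      smul_eq_mul]
  have hwc := ball_subset_closedBall hw
  have hwR : ‖w‖ < R := by simpa using hw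
  rw [key, h.log_norm hwc hfw, add_sub_right_comm, ← Finset.sum_sub_distrib]
  congr 1
  refine Finset.sum_congr rfl fun a ha => ?_
  rcases eq_or_ne (d a) 0 with hd | hd
  · simp [hd]
  have hwa : 0 < ‖w - a‖ := by
    rw [norm_pos_iff, sub_ne_zero]
    intro hwa
    exact hfw ((h.apply_eq_zero_iff hwc).2 ⟨a, ha, hwa, hd⟩)
  have hpos : 0 < ‖(R : ℂ) ^ 2 - conj a * w‖ :=
    (mul_pos hR (sub_pos.2 hwR)).trans_le (norm_sq_sub_conj_mul_pos (h.mem a ha) hwR)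
  rw [green, ← div_div, log_div (div_pos hpos hR).ne' hwa.ne']
  ring

/-! ### Estimates for Green's function and the Poisson kernel -/

theorem norm_sq_sub_conj_mul_sq (R : ℝ) (a w : ℂ) :
    ‖(R : ℂ) ^ 2 - conj a * w‖ ^ 2 = (R * ‖w - a‖) ^ 2 + (R ^ 2 - ‖a‖ ^ 2) * (R ^ 2 - ‖w‖ ^ 2) := by
  rw [mul_pow]
  simp only [← Complex.normSq_eq_norm_sq, Complex.normSq_apply, Complex.sub_re, Complex.sub_im,
    Complex.mul_re, Complex.mul_im, Complex.conj_re, Complex.conj_im, ← Complex.ofReal_pow,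
    Complex.ofReal_re, Complex.ofReal_im]
  ring

theorem le_norm_sq_sub_conj_mul {R : ℝ} {a w : ℂ} (ha : ‖a‖ ≤ R) (hw : ‖w‖ < R) :
    R * ‖w - a‖ ≤ ‖(R : ℂ) ^ 2 - conj a * w‖ := by
  refine le_of_sq_le_sq ?_ (norm_nonneg _)
  rw [norm_sq_sub_conj_mul_sq]
  nlinarith [mul_nonneg (sub_nonneg.2 (pow_le_pow_left₀ (norm_nonneg a) ha 2))
    (sub_nonneg.2 (pow_le_pow_left₀ (norm_nonneg w) hw.le 2))]

theorem green_nonneg {R : ℝ} {a w : ℂ} (ha : ‖a‖ ≤ R) (hw : ‖w‖ < R) : 0 ≤ green R w a := by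
  have hR : 0 < R := (norm_nonneg w).trans_lt hw
  rcases eq_or_ne w a with rfl | h
  · simp [green]
  · have : 0 < ‖w - a‖ := norm_pos_iff.2 (sub_ne_zero.2 h)
    exact log_nonneg ((one_le_div (by positivity)).2 (le_norm_sq_sub_conj_mul ha hw))

/-- Writing M = |R² - ā w|, the bound log x ≥ 1 - 1/x reduces the claim to M - R|w - a|. The squared
identity bounds 2M(M - R|w - a|) from below by R²(R - ρ)(R - s); M ≤ 2R² and M ≤ 2 then give the 8.
-/
theorem le_green {R ρ s : ℝ} {a w : ℂ} (hR1 : R ≤ 1) (ha : ‖a‖ ≤ ρ) (hρ : ρ ≤ R) (hw : ‖w‖ ≤ s)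
    (hs : s < R) (hwa : w ≠ a) : (R - ρ) * (R - s) / 8 ≤ green R w a := by
  have hR : 0 < R := (norm_nonneg w).trans_lt (hw.trans_lt hs)
  have hd : 0 < ‖w - a‖ := norm_pos_iff.2 (sub_ne_zero.2 hwa)
  set M := ‖(R : ℂ) ^ 2 - conj a * w‖ with hM
  have hle : R * ‖w - a‖ ≤ M := le_norm_sq_sub_conj_mul (ha.trans hρ) (hw.trans_lt hs)
  have hsq : M ^ 2 = _ := norm_sq_sub_conj_mul_sq R a w
  have hMpos : 0 < M := (mul_pos hR hd).trans_le hle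
  have hM2 : M ≤ 2 * R ^ 2 := by
    refine (norm_sub_le _ _).trans ?_
    rw [norm_pow, norm_mul, RCLike.norm_conj, Complex.norm_real, norm_of_nonneg hR.le]
    nlinarith [norm_nonneg w, norm_nonneg a, mul_le_mul (ha.trans hρ) (hw.trans hs.le)
      (norm_nonneg w) hR.le]
  have h1 : 1 - (M / (R * ‖w - a‖))⁻¹ ≤ green R w a :=
    one_sub_inv_le_log_of_pos (div_pos hMpos (mul_pos hR hd))
  refine le_trans ?_ h1
  rw [inv_div, one_sub_div hMpos.ne', div_le_div_iff₀ (by norm_num) hMpos]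
  have hA : R * (R - ρ) ≤ R ^ 2 - ‖a‖ ^ 2 := by nlinarith [norm_nonneg a]
  have hW : R * (R - s) ≤ R ^ 2 - ‖w‖ ^ 2 := by nlinarith [norm_nonneg w]
  have hAW := mul_le_mul hA hW (mul_nonneg hR.le (sub_nonneg.2 hs.le))
    ((mul_nonneg hR.le (sub_nonneg.2 hρ)).trans hA)
  have h2 : R ^ 2 * ((R - ρ) * (R - s)) ≤ 2 * M * (M - R * ‖w - a‖) := by
    nlinarith [mul_nonneg (sub_nonneg.2 hle) (sub_nonneg.2 hle)]
  have h3 : R ^ 2 * ((R - ρ) * (R - s)) ≤ R ^ 2 * (4 * (M - R * ‖w - a‖)) := by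
    nlinarith [mul_le_mul_of_nonneg_right hM2 (sub_nonneg.2 hle)]
  have h4 := le_of_mul_le_mul_left h3 (by positivity)
  have h5 : 0 ≤ (R - ρ) * (R - s) := mul_nonneg (sub_nonneg.2 hρ) (sub_nonneg.2 hs.le)
  have h6 : M ≤ 2 := by nlinarith
  nlinarith

/-- Only an upper bound is wanted, so log x ≤ x - 1 suffices and the singular term involves the
distance from `a` to `z` alone. A zero close to `w` does no harm, as it only makes |f(w)| smaller.
-/
theorem green_sub_green_le {R : ℝ} {a z w : ℂ} (ha : ‖a‖ ≤ R) (hz : ‖z‖ < R) (hw : ‖w‖ < R)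
    (hza : z ≠ a) (hwa : w ≠ a) :
    green R z a - green R w a ≤ ‖w - z‖ * ((R - ‖w‖)⁻¹ + ‖z - a‖⁻¹) := by
  have hR : 0 < R := (norm_nonneg w).trans_lt hw
  have hdz : 0 < ‖z - a‖ := norm_pos_iff.2 (sub_ne_zero.2 hza)
  have hdw : 0 < ‖w - a‖ := norm_pos_iff.2 (sub_ne_zero.2 hwa)
  set M := ‖(R : ℂ) ^ 2 - conj a * z‖ with hM
  set N := ‖(R : ℂ) ^ 2 - conj a * w‖ with hN
  have hMpos : 0 < M := (mul_pos hR hdz).trans_le (le_norm_sq_sub_conj_mul ha hz)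
  have hNge : R * (R - ‖w‖) ≤ N := norm_sq_sub_conj_mul_pos ha hw
  have hwp : 0 < R - ‖w‖ := sub_pos.2 hw
  have hNpos : 0 < N := (mul_pos hR hwp).trans_le hNge
  have e : green R z a - green R w a = log (M / N) + log (‖w - a‖ / ‖z - a‖) := by
    rw [green, green, log_div hMpos.ne' (by positivity), log_div hNpos.ne' (by positivity),
      log_mul hR.ne' hdz.ne', log_mul hR.ne' hdw.ne', log_div hMpos.ne' hNpos.ne',
      log_div hdw.ne' hdz.ne']
    ring
  have h1 : log (M / N) ≤ ‖w - z‖ * (R - ‖w‖)⁻¹ := by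
    refine (log_le_sub_one_of_pos (div_pos hMpos hNpos)).trans ?_
    have hMN : M - N ≤ R * ‖w - z‖ := by
      refine (norm_sub_norm_le _ _).trans ?_
      rw [show (R : ℂ) ^ 2 - conj a * z - ((R : ℂ) ^ 2 - conj a * w) = conj a * (w - z) by ring,
        norm_mul, RCLike.norm_conj]
      gcongr
    rw [div_sub_one hNpos.ne', ← div_eq_mul_inv]
    calc (M - N) / N ≤ R * ‖w - z‖ / N := by gcongr
      _ ≤ R * ‖w - z‖ / (R * (R - ‖w‖)) := by gcongr
      _ = ‖w - z‖ / (R - ‖w‖) := mul_div_mul_left _ _ hR.ne'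
  have h2 : log (‖w - a‖ / ‖z - a‖) ≤ ‖w - z‖ * ‖z - a‖⁻¹ := by
    refine (log_le_sub_one_of_pos (div_pos hdw hdz)).trans ?_
    rw [div_sub_one hdz.ne', ← div_eq_mul_inv]
    gcongr
    refine (norm_sub_norm_le _ _).trans ?_
    rw [sub_sub_sub_cancel_right]
  rw [e, mul_add]
  exact add_le_add h1 h2

/-- The zeros outside the smaller disc are absorbed into the zero-free factor. -/
theorem IsZeroFactorization.restrict {f g : ℂ → ℂ} {R ρ : ℝ} {s : Finset ℂ} {d : ℂ → ℕ}
    (h : IsZeroFactorization f R s d g) (hρ : ρ ≤ R) :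
    ∃ g', IsZeroFactorization f ρ {a ∈ s | ‖a‖ ≤ ρ} d g' := by
  have hsub : closedBall (0 : ℂ) ρ ⊆ closedBall 0 R := closedBall_subset_closedBall hρ
  refine ⟨fun z => (∏ a ∈ s with ¬ ‖a‖ ≤ ρ, (z - a) ^ d a) * g z, ?_, ?_, ?_, ?_⟩
  · intro z hz
    refine AnalyticAt.mul ?_ (h.analytic z (hsub hz))
    fun_prop
  · intro z hz
    refine mul_ne_zero (Finset.prod_ne_zero_iff.2 fun a ha => pow_ne_zero _ ?_)
      (h.ne_zero z (hsub hz))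
    rw [sub_ne_zero]
    rintro rfl
    exact (Finset.mem_filter.1 ha).2 (by simpa using hz)
  · intro a ha
    exact (Finset.mem_filter.1 ha).2
  · intro z hz
    rw [h.eq z (hsub hz), ← mul_assoc, Finset.prod_filter_mul_prod_filter_not]

theorem poissonKernel_le {R : ℝ} {z w : ℂ} (hz : z ∈ sphere (0 : ℂ) R) (hw : w ∈ ball (0 : ℂ) R) :
    poissonKernel 0 w z ≤ (R + ‖w‖) / (R - ‖w‖) := by
  rw [poissonKernel_eq_re_herglotzRieszKernel]
  simpa [herglotzRieszKernel_def] using re_herglotzRieszKernel_le hz hw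

theorem le_poissonKernel {R : ℝ} {z w : ℂ} (hz : z ∈ sphere (0 : ℂ) R) (hw : w ∈ ball (0 : ℂ) R) :
    (R - ‖w‖) / (R + ‖w‖) ≤ poissonKernel 0 w z := by
  rw [poissonKernel_eq_re_herglotzRieszKernel]
  simpa [herglotzRieszKernel_def] using le_re_herglotzRieszKernel hz hw

theorem poissonKernel_nonneg {R : ℝ} {z w : ℂ} (hz : z ∈ sphere (0 : ℂ) R)
    (hw : w ∈ ball (0 : ℂ) R) : 0 ≤ poissonKernel 0 w z := by
  have : ‖w‖ < R := by simpa using hw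
  exact (div_nonneg (by linarith) (by linarith [norm_nonneg w])).trans (le_poissonKernel hz hw)

theorem abs_poissonKernel_sub_le {R : ℝ} {ζ z w : ℂ} (hζ : ‖ζ‖ = R) (hz : ‖z‖ < R) (hw : ‖w‖ < R) :
    |poissonKernel 0 w ζ - poissonKernel 0 z ζ| ≤ 2 * R * ‖w - z‖ / ((R - ‖w‖) * (R - ‖z‖)) := by
  have hR : 0 < R := (norm_nonneg w).trans_lt hw
  have hzζ : R - ‖z‖ ≤ ‖ζ - z‖ := hζ ▸ norm_sub_norm_le _ _
  have hwζ : R - ‖w‖ ≤ ‖ζ - w‖ := hζ ▸ norm_sub_norm_le _ _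
  have hz0 : 0 < R - ‖z‖ := sub_pos.2 hz
  have hw0 : 0 < R - ‖w‖ := sub_pos.2 hw
  have h1 : ζ - z ≠ 0 := norm_pos_iff.1 (hz0.trans_le hzζ)
  have h2 : ζ - w ≠ 0 := norm_pos_iff.1 (hw0.trans_le hwζ)
  rw [poissonKernel_eq_re_herglotzRieszKernel, poissonKernel_eq_re_herglotzRieszKernel]
  simp only [Function.comp_apply, herglotzRieszKernel_def, sub_zero]
  rw [← Complex.sub_re]
  refine (Complex.abs_re_le_norm _).trans ?_
  have : (ζ + w) / (ζ - w) - (ζ + z) / (ζ - z) = 2 * ζ * (w - z) / ((ζ - w) * (ζ - z)) := by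
    field_simp
    ring
  rw [this, norm_div, norm_mul, norm_mul, norm_mul, hζ, Complex.norm_ofNat]
  gcongr

/-! ### Subharmonicity of log⁺|f| and monotonicity of its means -/

theorem circleIntegrable_posLog {f : ℂ → ℂ} {R : ℝ} (hR : 0 ≤ R)
    (hf : AnalyticOnNhd ℂ f (closedBall 0 R)) : CircleIntegrable (fun z => posLog ‖f z‖) 0 R := by
  refine MeromorphicOn.circleIntegrable_posLog_norm ?_
  rw [abs_of_nonneg hR]
  exact (hf.mono sphere_subset_closedBall).meromorphicOn

theorem circleIntegrable_log {f : ℂ → ℂ} {R : ℝ} (hR : 0 ≤ R)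
    (hf : AnalyticOnNhd ℂ f (closedBall 0 R)) : CircleIntegrable (fun z => log ‖f z‖) 0 R := by
  refine MeromorphicOn.circleIntegrable_log_norm ?_
  rw [abs_of_nonneg hR]
  exact (hf.mono sphere_subset_closedBall).meromorphicOn

/-- Poisson–Jensen with the nonnegative Green terms dropped and log replaced by log⁺. -/
theorem posLog_norm_le_circleAverage {f : ℂ → ℂ} {R : ℝ}
    (hf : AnalyticOnNhd ℂ f (closedBall 0 R)) {w : ℂ} (hw : w ∈ ball (0 : ℂ) R) :
    posLog ‖f w‖ ≤ circleAverage (poissonKernel 0 w • fun z => posLog ‖f z‖) 0 R := by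
  have hR : 0 < R := pos_of_mem_ball hw
  have hwR : ‖w‖ < R := by simpa using hw
  have h0 : 0 ≤ circleAverage (poissonKernel 0 w • fun z => posLog ‖f z‖) 0 R := by
    refine circleAverage_nonneg_of_nonneg fun z hz => ?_
    rw [abs_of_pos hR] at hz
    exact mul_nonneg (poissonKernel_nonneg hz hw) posLog_nonneg
  rcases eq_or_ne (f w) 0 with hfw | hfw
  · simpa [hfw] using h0
  · obtain ⟨s, d, g, h⟩ := exists_isZeroFactorization hR hf (ball_subset_closedBall hw) hfw
    refine max_le h0 ?_
    rw [h.log_norm_eq_circleAverage_sub hw hfw]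
    have hs : 0 ≤ ∑ a ∈ s, d a * green R w a := Finset.sum_nonneg fun a ha =>
      mul_nonneg (Nat.cast_nonneg _) (green_nonneg (h.mem a ha) hwR)
    refine (sub_le_self _ hs).trans (circleAverage_mono
      (circleIntegrable_poissonKernel_smul hw (circleIntegrable_log hR.le hf))
      (circleIntegrable_poissonKernel_smul hw (circleIntegrable_posLog hR.le hf)) ?_)
    intro z hz
    rw [abs_of_pos hR] at hz
    exact mul_le_mul_of_nonneg_left (le_max_right _ _) (poissonKernel_nonneg hz hw)

theorem continuous_comp_circleMap {r R : ℝ} {F : ℂ → ℂ → ℝ} (hr : 0 ≤ r) (hR : 0 ≤ R)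
    (hF : ContinuousOn (Function.uncurry F) (sphere (0 : ℂ) r ×ˢ sphere (0 : ℂ) R)) :
    Continuous (fun p : ℝ × ℝ => F (circleMap 0 r p.1) (circleMap 0 R p.2)) :=
  hF.comp_continuous (f := fun p : ℝ × ℝ => (circleMap (0:ℂ) r p.1, circleMap (0:ℂ) R p.2))
    (by fun_prop) fun _ => ⟨circleMap_mem_sphere _ hr _, circleMap_mem_sphere _ hR _⟩

theorem circleIntegrable_circleAverage {r R : ℝ} {F : ℂ → ℂ → ℝ} (hr : 0 ≤ r) (hR : 0 ≤ R)
    (hF : ContinuousOn (Function.uncurry F) (sphere (0 : ℂ) r ×ˢ sphere (0 : ℂ) R)) :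
    CircleIntegrable (fun w => circleAverage (fun z => F w z) 0 R) 0 r := by
  have h := intervalIntegral.continuous_parametric_intervalIntegral_of_continuous'
    (f := fun x y : ℝ => F (circleMap 0 r x) (circleMap 0 R y)) (μ := MeasureTheory.volume)
    (continuous_comp_circleMap hr hR hF) 0 (2 * π)
  simp only [circleAverage_def, CircleIntegrable]
  exact (h.const_smul ((2 * π)⁻¹ : ℝ)).intervalIntegrable _ _

theorem circleAverage_comm {r R : ℝ} {F : ℂ → ℂ → ℝ} (hr : 0 ≤ r) (hR : 0 ≤ R)
    (hF : ContinuousOn (Function.uncurry F) (sphere (0 : ℂ) r ×ˢ sphere (0 : ℂ) R)) :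
    circleAverage (fun w => circleAverage (fun z => F w z) 0 R) 0 r
      = circleAverage (fun z => circleAverage (fun w => F w z) 0 r) 0 R := by
  have hc := continuous_comp_circleMap hr hR hF
  have hπ : (0 : ℝ) ≤ 2 * π := by positivity
  have hint : MeasureTheory.Integrable
      (Function.uncurry fun x y : ℝ => F (circleMap 0 r x) (circleMap 0 R y))
      ((MeasureTheory.volume.restrict (Set.uIoc 0 (2 * π))).prod
        (MeasureTheory.volume.restrict (Set.Ioc 0 (2 * π)))) := by
    rw [MeasureTheory.Measure.prod_restrict, Set.uIoc_of_le hπ]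
    exact (hc.continuousOn.integrableOn_compact (isCompact_Icc.prod isCompact_Icc)).mono_set
      (Set.prod_mono Set.Ioc_subset_Icc_self Set.Ioc_subset_Icc_self)
  have := MeasureTheory.intervalIntegral_integral_swap hint
  simp only [circleAverage_def, smul_eq_mul, intervalIntegral.integral_const_mul]
  congr 2
  simpa only [intervalIntegral.integral_of_le hπ] using this

/-- In `w` the kernel is the real part of the holomorphic (ζ + w)/(ζ - w), whose value at 0 is 1. -/
theorem circleAverage_poissonKernel_left {r R : ℝ} {ζ : ℂ} (hr : 0 < r) (hrR : r < R)
    (hζ : ‖ζ‖ = R) : circleAverage (fun w => poissonKernel 0 w ζ) 0 r = 1 := by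
  have hne : ∀ w ∈ closedBall (0 : ℂ) r, ζ - w ≠ 0 := by
    intro w hw h
    rw [mem_closedBall_zero_iff, ← sub_eq_zero.1 h, hζ] at hw
    linarith
  have hd : DifferentiableOn ℂ (fun w => (ζ + w) / (ζ - w)) (closedBall 0 r) := by
    refine DifferentiableOn.div (by fun_prop) (by fun_prop) hne
  have h1 : DiffContOnCl ℂ (fun w => (ζ + w) / (ζ - w)) (ball 0 |r|) := by
    rw [abs_of_pos hr]
    exact hd.diffContOnCl_ball subset_rfl
  have h2 := h1.circleAverage
  have h3 : CircleIntegrable (fun w => (ζ + w) / (ζ - w)) 0 r :=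
    (hd.continuousOn.mono sphere_subset_closedBall).circleIntegrable hr.le
  have h4 := Complex.reCLM.circleAverage_comp_comm h3
  rw [h2] at h4
  have hζ0 : ζ ≠ 0 := by
    rw [← norm_pos_iff, hζ]
    exact hr.trans hrR
  simpa [poissonKernel_eq_re_herglotzRieszKernel, herglotzRieszKernel_def, Function.comp_def,
    div_self hζ0] using h4

/-- The proximity function of a holomorphic function is nondecreasing. -/
theorem circleAverage_posLog_mono {f : ℂ → ℂ} {r R : ℝ} (hr : 0 < r) (hrR : r < R)
    (hf : AnalyticOnNhd ℂ f (closedBall 0 R)) :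
    circleAverage (fun z => posLog ‖f z‖) 0 r ≤ circleAverage (fun z => posLog ‖f z‖) 0 R := by
  have hR := hr.trans hrR
  have hcu : ContinuousOn (fun z => posLog ‖f z‖) (closedBall 0 R) :=
    continuous_posLog.comp_continuousOn hf.continuousOn.norm
  have hF : ContinuousOn (Function.uncurry fun w z => poissonKernel 0 w z * posLog ‖f z‖)
      (sphere (0 : ℂ) r ×ˢ sphere (0 : ℂ) R) := by
    refine ContinuousOn.mul (f := fun p : ℂ × ℂ => poissonKernel 0 p.1 p.2)
      (g := fun p : ℂ × ℂ => posLog ‖f p.2‖) ?_ ?_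
    · simp only [poissonKernel_def]
      refine ContinuousOn.div (by fun_prop) (by fun_prop) ?_
      rintro ⟨w, z⟩ ⟨hw, hz⟩ h
      simp only [sub_zero, ne_eq, OfNat.ofNat_ne_zero, not_false_eq_true, pow_eq_zero_iff,
        norm_eq_zero, sub_eq_zero] at h
      simp only [mem_sphere_iff_norm, sub_zero] at hw hz
      rw [h, hw] at hz
      exact hrR.ne hz
    · exact hcu.comp continuousOn_snd fun p hp => sphere_subset_closedBall hp.2
  have hint : CircleIntegrable
      (fun w => circleAverage (fun z => poissonKernel 0 w z * posLog ‖f z‖) 0 R) 0 r :=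
    circleIntegrable_circleAverage hr.le hR.le hF
  -- Majorize by the Poisson integral, exchange the two means, and use that the kernel has mean 1 in
  -- `w`.
  calc circleAverage (fun z => posLog ‖f z‖) 0 r
      ≤ circleAverage (fun w => circleAverage
          (fun z => poissonKernel 0 w z * posLog ‖f z‖) 0 R) 0 r := by
        refine circleAverage_mono (circleIntegrable_posLog hr.le
          (hf.mono (closedBall_subset_closedBall hrR.le))) hint fun w hw => ?_
        refine posLog_norm_le_circleAverage hf ?_
        rw [abs_of_pos hr] at hw
        exact sphere_subset_ball hrR hw
    _ = circleAverage (fun z => circleAverage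
          (fun w => poissonKernel 0 w z * posLog ‖f z‖) 0 r) 0 R :=
        circleAverage_comm hr.le hR.le hF
    _ = circleAverage (fun z => posLog ‖f z‖) 0 R := by
        refine circleAverage_congr_sphere fun z hz => ?_
        rw [abs_of_pos hR] at hz
        have := circleAverage_poissonKernel_left hr hrR (by simpa using hz)
        simp_rw [mul_comm _ (posLog ‖f z‖), ← smul_eq_mul]
        rw [circleAverage_fun_smul, this, smul_eq_mul, mul_one]

/-! ### Circle means of |z - a|^(-1/2), uniformly in a -/

theorem two_div_pi_mul_min_le_norm_circleMap_sub_one {θ : ℝ} (h0 : 0 ≤ θ) (h1 : θ ≤ 2 * π) :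
    2 / π * min θ (2 * π - θ) ≤ ‖circleMap 0 1 θ - 1‖ := by
  have e : ‖circleMap 0 1 θ - 1‖ = 2 * |sin (θ / 2)| := by
    have := Complex.norm_exp_I_mul_ofReal_sub_one (x := θ)
    rw [circleMap, zero_add, Complex.ofReal_one, one_mul, mul_comm, this]
    simp
  have hs : 0 ≤ sin (θ / 2) := sin_nonneg_of_nonneg_of_le_pi (by linarith) (by linarith)
  rw [e, abs_of_nonneg hs]
  have hπ := pi_pos
  rcases le_total θ π with h | h
  · have := mul_le_sin (x := θ / 2) (by linarith) (by linarith)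
    calc 2 / π * min θ (2 * π - θ) ≤ 2 / π * θ := by gcongr; exact min_le_left _ _
      _ = 2 * (2 / π * (θ / 2)) := by ring
      _ ≤ _ := by gcongr
  · have := mul_le_sin (x := π - θ / 2) (by linarith) (by linarith)
    rw [sin_pi_sub] at this
    calc 2 / π * min θ (2 * π - θ) ≤ 2 / π * (2 * π - θ) := by gcongr; exact min_le_right _ _
      _ = 2 * (2 / π * (π - θ / 2)) := by ring
      _ ≤ _ := by gcongr

/-- Rotate `a` onto the positive axis. Moving |a| to r costs |r - |a||, which is at most the
distance itself; hence the factor 2 and a bound independent of `a`. -/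
theorem mul_norm_sub_one_le_two_mul_norm_sub {r : ℝ} (hr : 0 < r) (a : ℂ) (θ : ℝ) :
    r * ‖circleMap 0 1 θ - 1‖ ≤ 2 * ‖circleMap 0 r (θ + a.arg) - a‖ := by
  have e1 : circleMap 0 r (θ + a.arg) - a
      = (r * circleMap 0 1 θ - ‖a‖) * Complex.exp (a.arg * Complex.I) := by
    conv_lhs => rw [← Complex.norm_mul_exp_arg_mul_I a]
    simp only [circleMap, zero_add, Complex.ofReal_one, one_mul, Complex.norm_mul_exp_arg_mul_I]
    push_cast
    rw [add_mul, Complex.exp_add, sub_mul, Complex.norm_mul_exp_arg_mul_I, mul_assoc]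
  rw [e1, norm_mul, Complex.norm_exp_ofReal_mul_I, mul_one]
  have hc : ‖(r : ℂ) * circleMap 0 1 θ‖ = r := by
    simp [abs_of_pos hr]
  have h1 : |r - ‖a‖| ≤ ‖(r : ℂ) * circleMap 0 1 θ - ‖a‖‖ := by
    have := abs_norm_sub_norm_le ((r : ℂ) * circleMap 0 1 θ) (‖a‖ : ℂ)
    rwa [hc, Complex.norm_real, norm_norm] at this
  have h2 : ‖(r : ℂ) * circleMap 0 1 θ - r‖ ≤ ‖(r : ℂ) * circleMap 0 1 θ - ‖a‖‖ + |r - ‖a‖| := by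
    have := norm_sub_le ((r : ℂ) * circleMap 0 1 θ - ‖a‖) ((r : ℂ) - ‖a‖)
    rw [sub_sub_sub_cancel_right, ← Complex.ofReal_sub, Complex.norm_real] at this
    exact this
  calc r * ‖circleMap 0 1 θ - 1‖ = ‖(r : ℂ) * circleMap 0 1 θ - r‖ := by
        rw [← mul_sub_one, norm_mul, Complex.norm_real, norm_of_nonneg hr.le]
    _ ≤ _ := by linarith

/-- Pointwise majorant whose integral over a period is finite. -/
theorem rpow_neg_half_norm_sub_le {r : ℝ} (hr : 0 < r) (a : ℂ) {θ : ℝ} (h0 : 0 < θ)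
    (h1 : θ < 2 * π) :
    ‖circleMap 0 r (θ + a.arg) - a‖ ^ (-(1 / 2) : ℝ)
      ≤ (r / π) ^ (-(1 / 2) : ℝ) * (θ ^ (-(1 / 2) : ℝ) + (2 * π - θ) ^ (-(1 / 2) : ℝ)) := by
  have hπ := pi_pos
  have hmin : 0 < min θ (2 * π - θ) := lt_min h0 (by linarith)
  have h2 : r / π * min θ (2 * π - θ) ≤ ‖circleMap 0 r (θ + a.arg) - a‖ := by
    have h3 := two_div_pi_mul_min_le_norm_circleMap_sub_one h0.le h1.le
    have h4 := mul_norm_sub_one_le_two_mul_norm_sub hr a θ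
    have h5 := mul_le_mul_of_nonneg_left h3 hr.le
    have h6 : r * (2 / π * min θ (2 * π - θ)) = 2 * (r / π * min θ (2 * π - θ)) := by ring
    linarith
  have hrπ : 0 < r / π := by positivity
  refine (rpow_le_rpow_of_nonpos (mul_pos hrπ hmin) h2 (by norm_num)).trans ?_
  rw [mul_rpow hrπ.le hmin.le]
  gcongr
  have p1 : 0 ≤ θ ^ (-(1 / 2) : ℝ) := by positivity
  have p2 : 0 ≤ (2 * π - θ) ^ (-(1 / 2) : ℝ) := rpow_nonneg (by linarith) _
  rcases min_choice θ (2 * π - θ) with h | h <;> rw [h] <;> linarith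

theorem intervalIntegrable_rpow_majorant :
    IntervalIntegrable (fun θ : ℝ => θ ^ (-(1 / 2) : ℝ) + (2 * π - θ) ^ (-(1 / 2) : ℝ))
      MeasureTheory.volume 0 (2 * π) := by
  have h1 : IntervalIntegrable (fun θ : ℝ => θ ^ (-(1 / 2) : ℝ)) MeasureTheory.volume 0 (2 * π) :=
    intervalIntegral.intervalIntegrable_rpow' (by norm_num)
  refine h1.add ?_
  have := (h1.comp_sub_left (2 * π)).symm
  simpa using this

theorem intervalIntegrable_rpow_norm_sub {r : ℝ} (hr : 0 < r) (a : ℂ) :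
    IntervalIntegrable (fun θ => ‖circleMap 0 r (θ + a.arg) - a‖ ^ (-(1 / 2) : ℝ))
      MeasureTheory.volume 0 (2 * π) := by
  refine (intervalIntegrable_rpow_majorant.const_mul ((r / π) ^ (-(1 / 2) : ℝ))).mono_fun' ?_ ?_
  · refine Measurable.aestronglyMeasurable ?_
    fun_prop
  · rw [Set.uIoc_of_le (by positivity)]
    have hne : ∀ᵐ θ ∂(MeasureTheory.volume.restrict (Set.Ioc 0 (2 * π))), θ ≠ 2 * π :=
      MeasureTheory.ae_restrict_of_ae (MeasureTheory.Measure.ae_ne _ _)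
    filter_upwards [hne, MeasureTheory.ae_restrict_mem measurableSet_Ioc] with θ h1 h2
    rw [norm_of_nonneg (by positivity)]
    exact rpow_neg_half_norm_sub_le hr a h2.1 (lt_of_le_of_ne h2.2 h1)

theorem circleIntegrable_rpow_norm_sub {r : ℝ} (hr : 0 < r) (a : ℂ) :
    CircleIntegrable (fun z => ‖z - a‖ ^ (-(1 / 2) : ℝ)) 0 r := by
  have hper : Function.Periodic (fun θ => ‖circleMap 0 r θ - a‖ ^ (-(1 / 2) : ℝ)) (2 * π) := by
    intro θ
    simp only [periodic_circleMap 0 r θ]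
  have h2 := (intervalIntegrable_rpow_norm_sub hr a).comp_sub_right a.arg
  simp only [sub_add_cancel, zero_add] at h2
  have h3 := hper.intervalIntegrable (t := a.arg) (by positivity) (by rwa [add_comm])
  exact h3 0 (2 * π)

theorem circleAverage_rpow_norm_sub_le {r : ℝ} (hr : 0 < r) (a : ℂ) :
    circleAverage (fun z => ‖z - a‖ ^ (-(1 / 2) : ℝ)) 0 r ≤ 4 * r ^ (-(1 / 2) : ℝ) := by
  have hπ := pi_pos
  have h1 : ∫ θ in (0 : ℝ)..(2 * π), θ ^ (-(1 / 2) : ℝ) = 2 * (2 * π) ^ (1 / 2 : ℝ) := by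
    rw [integral_rpow (Or.inl (by norm_num))]
    norm_num
    ring
  have hi : IntervalIntegrable (fun θ : ℝ => θ ^ (-(1 / 2) : ℝ)) MeasureTheory.volume 0 (2 * π) :=
    intervalIntegral.intervalIntegrable_rpow' (by norm_num)
  have h2 : ∫ θ in (0 : ℝ)..(2 * π), (2 * π - θ) ^ (-(1 / 2) : ℝ) = 2 * (2 * π) ^ (1 / 2 : ℝ) := by
    rw [intervalIntegral.integral_comp_sub_left (fun θ => θ ^ (-(1 / 2) : ℝ))]
    simpa using h1
  have hi2 : IntervalIntegrable (fun θ : ℝ => (2 * π - θ) ^ (-(1 / 2) : ℝ))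
      MeasureTheory.volume 0 (2 * π) := by
    simpa using (hi.comp_sub_left (2 * π)).symm
  rw [circleAverage_eq_integral_add a.arg, smul_eq_mul]
  have h3 : ∫ θ in (0 : ℝ)..(2 * π), ‖circleMap 0 r (θ + a.arg) - a‖ ^ (-(1 / 2) : ℝ)
      ≤ ∫ θ in (0 : ℝ)..(2 * π), (r / π) ^ (-(1 / 2) : ℝ)
        * (θ ^ (-(1 / 2) : ℝ) + (2 * π - θ) ^ (-(1 / 2) : ℝ)) := by
    exact intervalIntegral.integral_mono_on_of_le_Ioo (by positivity)
      (intervalIntegrable_rpow_norm_sub hr a) (intervalIntegrable_rpow_majorant.const_mul _)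
      fun θ hθ => rpow_neg_half_norm_sub_le hr a hθ.1 hθ.2
  rw [intervalIntegral.integral_const_mul, intervalIntegral.integral_add hi hi2, h1, h2] at h3
  have h4 : (r / π) ^ (-(1 / 2) : ℝ) = r ^ (-(1 / 2) : ℝ) * π ^ (1 / 2 : ℝ) := by
    rw [div_rpow hr.le hπ.le, rpow_neg hπ.le, div_inv_eq_mul]
  have h5 : π ^ (1 / 2 : ℝ) * (2 * π) ^ (1 / 2 : ℝ) ≤ 2 * π := by
    calc π ^ (1 / 2 : ℝ) * (2 * π) ^ (1 / 2 : ℝ)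
        ≤ (2 * π) ^ (1 / 2 : ℝ) * (2 * π) ^ (1 / 2 : ℝ) := by
          gcongr
          linarith
      _ = 2 * π := by
          rw [← rpow_add (by positivity)]
          norm_num
  rw [inv_mul_le_iff₀ (by positivity)]
  refine h3.trans ?_
  rw [h4]
  have h6 : 0 ≤ r ^ (-(1 / 2) : ℝ) := by positivity
  nlinarith [mul_le_mul_of_nonneg_left h5 h6]

/-! ### Consequences of a lower bound at one point -/

theorem circleIntegrable_posLog_inv {f : ℂ → ℂ} {R : ℝ} (hR : 0 ≤ R)
    (hf : AnalyticOnNhd ℂ f (closedBall 0 R)) :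
    CircleIntegrable (fun z => posLog ‖f z‖⁻¹) 0 R := by
  have h := (circleIntegrable_posLog hR hf).sub (circleIntegrable_log hR hf)
  refine h.congr ?_
  intro θ _
  simp [← posLog_sub_posLog_inv]

/-- A lower bound for `f` at one interior point controls the mean of `|log |f||` on the circle and
the number of zeros in smaller discs. -/
theorem IsZeroFactorization.circleAverage_abs_log_le_and_card_le {f g : ℂ → ℂ} {R κ c : ℝ}
    {s : Finset ℂ} {d : ℂ → ℕ} (h : IsZeroFactorization f R s d g)
    (hf : AnalyticOnNhd ℂ f (closedBall 0 R)) {w : ℂ} (hκ : 0 < κ) (hκR : κ ≤ R - ‖w‖)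
    (hR1 : R ≤ 1) (hc : 0 < c) (hcw : c ≤ ‖f w‖) :
    circleAverage (fun z => |log ‖f z‖|) 0 R
      ≤ 8 / κ * (2 / κ * circleAverage (fun z => posLog ‖f z‖) 0 R + |log c|) ∧
    ∀ ρ ≤ R, (R - ρ) * ∑ a ∈ s with ‖a‖ ≤ ρ, (d a : ℝ)
      ≤ 8 / κ * (2 / κ * circleAverage (fun z => posLog ‖f z‖) 0 R + |log c|) := by
  have hw0 := norm_nonneg w
  have hR : 0 < R := by linarith
  have hwR : ‖w‖ < R := by linarith
  have hw : w ∈ ball (0 : ℂ) R := by simpa using hwR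
  have hfw : f w ≠ 0 := norm_pos_iff.1 (hc.trans_le hcw)
  have hp := circleIntegrable_posLog hR.le hf
  have hn := circleIntegrable_posLog_inv hR.le hf
  set Tp := circleAverage (fun z => posLog ‖f z‖) 0 R with hTp
  set Tn := circleAverage (fun z => posLog ‖f z‖⁻¹) 0 R with hTn
  have hTp0 : 0 ≤ Tp := circleAverage_nonneg_of_nonneg fun z _ => posLog_nonneg
  have hTn0 : 0 ≤ Tn := circleAverage_nonneg_of_nonneg fun z _ => posLog_nonneg
  set E := 2 / κ * Tp + |log c| with hE
  have hE0 : 0 ≤ E := by positivity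
  have hgreen : 0 ≤ ∑ a ∈ s, d a * green R w a := Finset.sum_nonneg fun a ha =>
    mul_nonneg (Nat.cast_nonneg _) (green_nonneg (h.mem a ha) hwR)
  have hPp : circleAverage (poissonKernel 0 w • fun z => posLog ‖f z‖) 0 R ≤ 2 / κ * Tp := by
    rw [hTp, ← smul_eq_mul, ← circleAverage_fun_smul]
    refine circleAverage_mono (circleIntegrable_poissonKernel_smul hw hp) hp.const_smul ?_
    intro z hz
    rw [abs_of_pos hR] at hz
    refine mul_le_mul_of_nonneg_right ((poissonKernel_le hz hw).trans ?_) posLog_nonneg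
    exact div_le_div₀ (by norm_num) (by linarith) hκ hκR
  have hPn : κ / 2 * Tn ≤ circleAverage (poissonKernel 0 w • fun z => posLog ‖f z‖⁻¹) 0 R := by
    rw [hTn, ← smul_eq_mul, ← circleAverage_fun_smul]
    refine circleAverage_mono hn.const_smul (circleIntegrable_poissonKernel_smul hw hn) ?_
    intro z hz
    rw [abs_of_pos hR] at hz
    refine mul_le_mul_of_nonneg_right (le_trans ?_ (le_poissonKernel hz hw)) posLog_nonneg
    exact div_le_div₀ (by linarith) hκR (by linarith) (by linarith)
  have hPJ := h.log_norm_eq_circleAverage_sub hw hfw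
  have hsplit : circleAverage (poissonKernel 0 w • fun z => log ‖f z‖) 0 R
      = circleAverage (poissonKernel 0 w • fun z => posLog ‖f z‖) 0 R
        - circleAverage (poissonKernel 0 w • fun z => posLog ‖f z‖⁻¹) 0 R := by
    rw [← circleAverage_sub (circleIntegrable_poissonKernel_smul hw hp)
      (circleIntegrable_poissonKernel_smul hw hn), ← smul_sub]
    congr 2
    ext z
    exact posLog_sub_posLog_inv.symm
  have hlog : -|log c| ≤ log ‖f w‖ := (neg_abs_le _).trans (log_le_log hc hcw)
  -- Poisson–Jensen at `w`, rearranged: the mean of log⁺(1/|f|) and the Green sum are both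
  -- nonnegative, so `E` bounds each separately.
  have hmain : κ / 2 * Tn + ∑ a ∈ s, d a * green R w a ≤ E := by linarith
  have hκ1 : κ ≤ 1 := by linarith
  have hTnE : Tn ≤ 2 / κ * E := by
    rw [div_mul_eq_mul_div, le_div_iff₀ hκ]
    linarith
  have hTpE : Tp ≤ 2 / κ * E := by
    have h1 : 2 ≤ 2 / κ := by
      rw [le_div_iff₀ hκ]
      linarith
    have h2 : Tp ≤ E := by nlinarith [abs_nonneg (log c)]
    nlinarith
  have h8 : 8 / κ * E = 4 * (2 / κ * E) := by ring
  refine ⟨?_, fun ρ hρ => ?_⟩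
  · have : (fun z => |log ‖f z‖|) = fun z => posLog ‖f z‖ + posLog ‖f z‖⁻¹ := by
      ext z
      rw [← half_mul_log_add_log_abs, ← half_mul_log_add_log_abs, log_inv, abs_neg]
      ring
    rw [this, circleAverage_fun_add hp hn]
    linarith
  · have hsub : ∑ a ∈ s with ‖a‖ ≤ ρ, d a * green R w a ≤ ∑ a ∈ s, d a * green R w a :=
      Finset.sum_le_sum_of_subset_of_nonneg (Finset.filter_subset _ _) fun a ha _ =>
        mul_nonneg (Nat.cast_nonneg _) (green_nonneg (h.mem a ha) hwR)
    have hlow : ∑ a ∈ s with ‖a‖ ≤ ρ, (d a : ℝ) * ((R - ρ) * κ / 8)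
        ≤ ∑ a ∈ s with ‖a‖ ≤ ρ, d a * green R w a := by
      refine Finset.sum_le_sum fun a ha => ?_
      rcases eq_or_ne (d a) 0 with hd | hd
      · simp [hd]
      have hwa : w ≠ a := fun hwa => hfw ((h.apply_eq_zero_iff (ball_subset_closedBall hw)).2
        ⟨a, (Finset.mem_filter.1 ha).1, hwa, hd⟩)
      refine mul_le_mul_of_nonneg_left ?_ (Nat.cast_nonneg _)
      refine le_trans ?_ (le_green hR1 (Finset.mem_filter.1 ha).2 hρ le_rfl hwR hwa)
      have : 0 ≤ R - ρ := sub_nonneg.2 hρ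
      gcongr
    rw [← Finset.sum_mul] at hlow
    have hκTn : 0 ≤ κ / 2 * Tn := by positivity
    rw [div_mul_eq_mul_div, le_div_iff₀ hκ]
    linarith

/-! ### Pointwise bound for f⁽ᵏ⁾/f -/

/-- Growth of `f` near a point, in terms of the zeros and the boundary values of `log |f|`. -/
theorem IsZeroFactorization.norm_le_exp_one_mul_norm {f g : ℂ → ℂ} {R : ℝ}
    {s : Finset ℂ} {d : ℂ → ℕ} (h : IsZeroFactorization f R s d g)
    (hf : AnalyticOnNhd ℂ f (closedBall 0 R)) {z w : ℂ} {H : ℝ} (hR1 : R ≤ 1) (hz : ‖z‖ < R)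
    (hfz : f z ≠ 0)
    (hH : 2 * (∑ a ∈ s, (d a : ℝ)) / (R - ‖z‖)
      + 4 * circleAverage (fun ζ => |log ‖f ζ‖|) 0 R / (R - ‖z‖) ^ 2 + 2 / (R - ‖z‖) ≤ H)
    (hw : ‖w - z‖ * (∑ a ∈ s, d a * ‖z - a‖⁻¹ + H) ≤ 1) :
    ‖f w‖ ≤ exp 1 * ‖f z‖ := by
  rcases eq_or_ne (f w) 0 with hfw | hfw
  · rw [hfw, norm_zero]
    positivity
  have hR : 0 < R := (norm_nonneg z).trans_lt hz
  set t := R - ‖z‖ with ht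
  have ht0 : 0 < t := sub_pos.2 hz
  set nn := ∑ a ∈ s, (d a : ℝ) with hnn
  have hnn0 : 0 ≤ nn := Finset.sum_nonneg fun a _ => Nat.cast_nonneg _
  set S := ∑ a ∈ s, d a * ‖z - a‖⁻¹ with hS
  have hS0 : 0 ≤ S := Finset.sum_nonneg fun a _ => by positivity
  set Q := circleAverage (fun ζ => |log ‖f ζ‖|) 0 R with hQ
  have hQ0 : 0 ≤ Q := circleAverage_nonneg_of_nonneg fun _ _ => abs_nonneg _
  set δ := ‖w - z‖ with hδ
  have hδ0 : 0 ≤ δ := norm_nonneg _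
  -- The summand 2/t in `H` keeps `w` within half the distance from `z` to the circle.
  have hδt : δ ≤ t / 2 := by
    have h1 : 2 / t ≤ S + H := by
      have : 0 ≤ 2 * nn / t + 4 * Q / t ^ 2 := by positivity
      linarith
    have h2 : δ * (2 / t) ≤ 1 := (mul_le_mul_of_nonneg_left h1 hδ0).trans hw
    rw [mul_div_assoc', div_le_one ht0] at h2
    linarith
  have hwz : ‖w‖ ≤ ‖z‖ + δ := by
    have := norm_add_le z (w - z)
    rwa [add_sub_cancel] at this
  have hwt : t / 2 ≤ R - ‖w‖ := by linarith
  have hwR : ‖w‖ < R := by linarith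
  have hzb : z ∈ ball (0 : ℂ) R := by simpa using hz
  have hwb : w ∈ ball (0 : ℂ) R := by simpa using hwR
  have hl := circleIntegrable_log hR.le hf
  have hP : circleAverage (poissonKernel 0 w • fun ζ => log ‖f ζ‖) 0 R
      - circleAverage (poissonKernel 0 z • fun ζ => log ‖f ζ‖) 0 R ≤ 4 * δ / t ^ 2 * Q := by
    rw [← circleAverage_sub (circleIntegrable_poissonKernel_smul hwb hl)
      (circleIntegrable_poissonKernel_smul hzb hl), ← sub_smul, hQ, ← smul_eq_mul,
      ← circleAverage_fun_smul]
    refine circleAverage_mono ?_ hl.abs.const_smul ?_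
    · rw [sub_smul]
      exact (circleIntegrable_poissonKernel_smul hwb hl).sub
        (circleIntegrable_poissonKernel_smul hzb hl)
    · intro ζ hζ
      rw [abs_of_pos hR] at hζ
      refine (le_abs_self _).trans ?_
      rw [Pi.smul_apply', smul_eq_mul, abs_mul, smul_eq_mul]
      refine mul_le_mul_of_nonneg_right ?_ (abs_nonneg _)
      refine (abs_poissonKernel_sub_le (by simpa using hζ) hz hwR).trans ?_
      calc 2 * R * δ / ((R - ‖w‖) * t) ≤ 2 * 1 * δ / (t / 2 * t) := by gcongr
        _ = 4 * δ / t ^ 2 := by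
          field_simp
          ring
  have hG : ∑ a ∈ s, d a * green R z a - ∑ a ∈ s, d a * green R w a ≤ δ * (nn * (2 / t) + S) := by
    rw [← Finset.sum_sub_distrib, hnn, hS, Finset.sum_mul, ← Finset.sum_add_distrib,
      Finset.mul_sum]
    refine Finset.sum_le_sum fun a ha => ?_
    rcases eq_or_ne (d a) 0 with hd | hd
    · simp [hd]
    have hza : z ≠ a := fun hza => hfz ((h.apply_eq_zero_iff (ball_subset_closedBall hzb)).2
        ⟨a, ha, hza, hd⟩)
    have hwa : w ≠ a := fun hwa => hfw ((h.apply_eq_zero_iff (ball_subset_closedBall hwb)).2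
        ⟨a, ha, hwa, hd⟩)
    have h1 := green_sub_green_le (h.mem a ha) hz hwR hza hwa
    have h2 : (R - ‖w‖)⁻¹ ≤ 2 / t := by
      rw [← inv_div]
      gcongr
    calc (d a : ℝ) * green R z a - d a * green R w a = d a * (green R z a - green R w a) := by ring
      _ ≤ d a * (δ * (2 / t + ‖z - a‖⁻¹)) := by
        gcongr
        exact h1.trans (by gcongr)
      _ = _ := by ring
  have hlog : log ‖f w‖ - log ‖f z‖ ≤ 1 := by
    rw [h.log_norm_eq_circleAverage_sub hwb hfw, h.log_norm_eq_circleAverage_sub hzb hfz]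
    have h3 : δ * (2 * nn / t + 4 * Q / t ^ 2 + 2 / t) ≤ δ * H := by gcongr
    have h4 : 4 * δ / t ^ 2 * Q + δ * (nn * (2 / t) + S) + δ * (2 / t)
        = δ * (2 * nn / t + 4 * Q / t ^ 2 + 2 / t) + δ * S := by ring
    have h5 : 0 ≤ δ * (2 / t) := by positivity
    linarith
  rw [← exp_log (norm_pos_iff.2 hfw), ← exp_log (norm_pos_iff.2 hfz), ← exp_add]
  exact exp_le_exp.2 (by linarith)

/-- Cauchy's estimate on the circle of radius 1/D about `z`, where |f| ≤ e |f(z)|. -/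
theorem IsZeroFactorization.norm_iteratedDeriv_div_le {f g : ℂ → ℂ} {R : ℝ}
    {s : Finset ℂ} {d : ℂ → ℕ} (h : IsZeroFactorization f R s d g)
    (hf : AnalyticOnNhd ℂ f (closedBall 0 R)) {z : ℂ} {H : ℝ} (hR1 : R ≤ 1) (hz : ‖z‖ < R)
    (hH : 2 * (∑ a ∈ s, (d a : ℝ)) / (R - ‖z‖)
      + 4 * circleAverage (fun ζ => |log ‖f ζ‖|) 0 R / (R - ‖z‖) ^ 2 + 2 / (R - ‖z‖) ≤ H)
    (k : ℕ) :
    ‖iteratedDeriv k f z / f z‖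
      ≤ k.factorial * exp 1 * (∑ a ∈ s, d a * ‖z - a‖⁻¹ + H) ^ k := by
  have ht0 : 0 < R - ‖z‖ := sub_pos.2 hz
  have hS0 : 0 ≤ ∑ a ∈ s, d a * ‖z - a‖⁻¹ := Finset.sum_nonneg fun a _ => by positivity
  have hnn0 : 0 ≤ ∑ a ∈ s, (d a : ℝ) := Finset.sum_nonneg fun a _ => Nat.cast_nonneg _
  have hQ0 : 0 ≤ circleAverage (fun ζ => |log ‖f ζ‖|) 0 R :=
    circleAverage_nonneg_of_nonneg fun _ _ => abs_nonneg _
  have hHt : 2 / (R - ‖z‖) ≤ H := by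
    refine le_trans ?_ hH
    have : 0 ≤ 2 * (∑ a ∈ s, (d a : ℝ)) / (R - ‖z‖)
      + 4 * circleAverage (fun ζ => |log ‖f ζ‖|) 0 R / (R - ‖z‖) ^ 2 := by positivity
    linarith
  have hH0 : 0 < H := lt_of_lt_of_le (by positivity) hHt
  set D := ∑ a ∈ s, d a * ‖z - a‖⁻¹ + H with hD
  have hD0 : 0 < D := by linarith
  rcases eq_or_ne (f z) 0 with hfz | hfz
  · rw [hfz, div_zero, norm_zero]
    positivity
  have hsub : closedBall z D⁻¹ ⊆ closedBall (0 : ℂ) R := by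
    refine closedBall_subset_closedBall' ?_
    rw [dist_zero_right]
    have : D⁻¹ ≤ (2 / (R - ‖z‖))⁻¹ := by
      gcongr
      linarith
    rw [inv_div] at this
    linarith
  have hcauchy := Complex.norm_iteratedDeriv_le_of_forall_mem_sphere_norm_le (F := ℂ) (f := f)
    (c := z) (C := exp 1 * ‖f z‖) k (inv_pos.2 hD0)
    ((hf.mono hsub).differentiableOn.diffContOnCl_ball subset_rfl) (fun w hw => by
      refine h.norm_le_exp_one_mul_norm hf hR1 hz hfz hH ?_
      rw [mem_sphere_iff_norm.1 hw, ← hD, inv_mul_cancel₀ hD0.ne'])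
  rw [norm_div, div_le_iff₀ (norm_pos_iff.2 hfz)]
  refine hcauchy.trans_eq ?_
  rw [inv_pow, div_inv_eq_mul]
  ring

/-! ### The lemma on the logarithmic derivative -/

theorem analyticOnNhd_iteratedDeriv {f : ℂ → ℂ} {s : Set ℂ} (hf : AnalyticOnNhd ℂ f s) (k : ℕ) :
    AnalyticOnNhd ℂ (iteratedDeriv k f) s := by
  rw [iteratedDeriv_eq_iterate]
  exact hf.iterated_deriv k

theorem circleIntegrable_posLog_iteratedDeriv_div {f : ℂ → ℂ} {r : ℝ} (hr : 0 ≤ r)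
    (hf : AnalyticOnNhd ℂ f (closedBall 0 r)) (k : ℕ) :
    CircleIntegrable (fun z => posLog ‖iteratedDeriv k f z / f z‖) 0 r := by
  refine MeromorphicOn.circleIntegrable_posLog_norm (f := fun z => iteratedDeriv k f z / f z) ?_
  rw [abs_of_nonneg hr]
  have hf' := hf.mono (sphere_subset_closedBall (x := (0 : ℂ)) (ε := r))
  exact (analyticOnNhd_iteratedDeriv hf' k).meromorphicOn.div hf'.meromorphicOn

/-- |z - a|⁻¹ is not integrable on a circle through `a`, but its square root is; under a logarithm
the square costs only a factor 2. Integrality of the multiplicities gives d ≤ d². -/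
theorem sum_mul_inv_le_sq (s : Finset ℂ) (d : ℂ → ℕ) (z : ℂ) :
    ∑ a ∈ s, d a * ‖z - a‖⁻¹ ≤ (∑ a ∈ s, d a * ‖z - a‖ ^ (-(1 / 2) : ℝ)) ^ 2 := by
  have h0 : ∀ a ∈ s, 0 ≤ (d a : ℝ) * ‖z - a‖ ^ (-(1 / 2) : ℝ) := fun a _ => by positivity
  have hX : 0 ≤ ∑ a ∈ s, (d a : ℝ) * ‖z - a‖ ^ (-(1 / 2) : ℝ) := Finset.sum_nonneg h0
  rw [sq, Finset.sum_mul]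
  refine Finset.sum_le_sum fun a ha => ?_
  have h1 : ‖z - a‖⁻¹ = (‖z - a‖ ^ (-(1 / 2) : ℝ)) ^ 2 := by
    rw [← rpow_natCast, ← rpow_mul (norm_nonneg _), ← rpow_neg_one]
    norm_num
  have h2 := Finset.single_le_sum h0 ha
  have h3 : (d a : ℝ) ≤ (d a : ℝ) * d a := by exact_mod_cast Nat.le_mul_self _
  calc (d a : ℝ) * ‖z - a‖⁻¹ ≤ d a * d a * ‖z - a‖⁻¹ := by gcongr
    _ = (d a * ‖z - a‖ ^ (-(1 / 2) : ℝ)) * (d a * ‖z - a‖ ^ (-(1 / 2) : ℝ)) := by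
      rw [h1]
      ring
    _ ≤ _ := mul_le_mul_of_nonneg_left h2 (h0 a ha)

theorem IsZeroFactorization.circleAverage_posLog_iteratedDeriv_div_le {f g : ℂ → ℂ} {R r H : ℝ}
    {s : Finset ℂ} {d : ℂ → ℕ} (h : IsZeroFactorization f R s d g)
    (hf : AnalyticOnNhd ℂ f (closedBall 0 R)) (hR1 : R ≤ 1) (hr : 0 < r) (hrR : r < R)
    (hH1 : 1 ≤ H)
    (hH : 2 * (∑ a ∈ s, (d a : ℝ)) / (R - r)
      + 4 * circleAverage (fun ζ => |log ‖f ζ‖|) 0 R / (R - r) ^ 2 + 2 / (R - r) ≤ H)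
    (k : ℕ) :
    circleAverage (fun z => posLog ‖iteratedDeriv k f z / f z‖) 0 r
      ≤ log (k.factorial * exp 1)
        + 2 * k * log (H + 4 * r ^ (-(1 / 2) : ℝ) * ∑ a ∈ s, (d a : ℝ)) := by
  set nn := ∑ a ∈ s, (d a : ℝ) with hnn
  have hnn0 : 0 ≤ nn := Finset.sum_nonneg fun a _ => Nat.cast_nonneg _
  set M := H + 4 * r ^ (-(1 / 2) : ℝ) * nn with hM
  have hM0 : 0 < M := by positivity
  set X : ℂ → ℝ := fun z => ∑ a ∈ s, (d a : ℝ) • ‖z - a‖ ^ (-(1 / 2) : ℝ) with hX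
  have hXi : ∀ a ∈ s, CircleIntegrable (fun z => (d a : ℝ) • ‖z - a‖ ^ (-(1 / 2) : ℝ)) 0 r :=
    fun a _ => (circleIntegrable_rpow_norm_sub hr a).const_smul
  have hXint : CircleIntegrable X 0 r := CircleIntegrable.fun_sum s hXi
  have hXavg : circleAverage X 0 r ≤ M - H := by
    rw [hX, circleAverage_fun_sum hXi, hM, add_sub_cancel_left, hnn, Finset.mul_sum]
    refine Finset.sum_le_sum fun a _ => ?_
    rw [circleAverage_fun_smul, smul_eq_mul, mul_comm]
    exact mul_le_mul_of_nonneg_right (circleAverage_rpow_norm_sub_le hr a) (Nat.cast_nonneg _)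
  have hfac1 : 1 ≤ (k.factorial : ℝ) * exp 1 := by
    have h1 : (1 : ℝ) ≤ k.factorial := by exact_mod_cast Nat.one_le_iff_ne_zero.2 k.factorial_ne_zero
    have h2 : (1 : ℝ) ≤ exp 1 := one_le_exp zero_le_one
    nlinarith
  have hpt : ∀ z ∈ sphere (0 : ℂ) |r|, posLog ‖iteratedDeriv k f z / f z‖
      ≤ (log (k.factorial * exp 1) + 2 * k * (log M + H / M - 1)) + (2 * k / M) • X z := by
    intro z hz
    rw [abs_of_pos hr, mem_sphere_zero_iff_norm] at hz
    have hb := h.norm_iteratedDeriv_div_le hf (H := H) hR1 (hz.trans_lt hrR)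
      (by rwa [hz]) k
    have hS0 : 0 ≤ ∑ a ∈ s, d a * ‖z - a‖⁻¹ := Finset.sum_nonneg fun a _ => by positivity
    have hX0 : 0 ≤ X z := Finset.sum_nonneg fun a _ => by positivity
    have hXH : 0 < X z + H := by linarith
    have hDX : ∑ a ∈ s, d a * ‖z - a‖⁻¹ + H ≤ (X z + H) ^ 2 := by
      have := sum_mul_inv_le_sq s d z
      simp only [hX, smul_eq_mul] at hX0 ⊢
      nlinarith
    have hD1 : 1 ≤ ∑ a ∈ s, d a * ‖z - a‖⁻¹ + H := by linarith
    have h1 : posLog ‖iteratedDeriv k f z / f z‖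
        ≤ log (k.factorial * exp 1) + k * log (∑ a ∈ s, d a * ‖z - a‖⁻¹ + H) := by
      refine (posLog_le_posLog (norm_nonneg _) hb).trans (posLog_mul.trans ?_)
      rw [posLog_pow, posLog_eq_log (hfac1.trans (le_abs_self _)),
        posLog_eq_log (hD1.trans (le_abs_self _))]
    have h2 : log (∑ a ∈ s, d a * ‖z - a‖⁻¹ + H) ≤ 2 * log (X z + H) := by
      have := log_le_log (by linarith) hDX
      rwa [log_pow, Nat.cast_ofNat] at this
    -- Jensen's inequality for log, via the tangent at `M`, which bounds the mean of `X + H`.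
    have h3 : log (X z + H) ≤ log M + (X z + H) / M - 1 := by
      have := log_le_sub_one_of_pos (div_pos hXH hM0)
      rw [log_div hXH.ne' hM0.ne'] at this
      linarith
    have h4 : (k : ℝ) * log (∑ a ∈ s, d a * ‖z - a‖⁻¹ + H)
        ≤ k * (2 * (log M + (X z + H) / M - 1)) := by
      gcongr
      linarith
    refine h1.trans ((add_le_add_right h4 _).trans_eq ?_)
    rw [smul_eq_mul]
    ring
  have hXs : CircleIntegrable (fun z => (2 * k / M) • X z) 0 r := hXint.const_smul
  have hfr := hf.mono (closedBall_subset_closedBall hrR.le)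
  refine (circleAverage_mono (circleIntegrable_posLog_iteratedDeriv_div hr.le hfr k)
    ((circleIntegrable_const _ _ _).add hXs) hpt).trans ?_
  rw [circleAverage_add (circleIntegrable_const _ _ _) hXs, circleAverage_const,
    circleAverage_fun_smul, smul_eq_mul]
  have h5 : 2 * k / M * circleAverage X 0 r ≤ 2 * k / M * (M - H) := by gcongr
  have h6 : 2 * k / M * (M - H) = 2 * k * (1 - H / M) := by
    field_simp
  rw [h6] at h5
  linarith

set_option maxHeartbeats 1000000 in
/-- The lemma on the logarithmic derivative for a holomorphic function on the unit disc which is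
bounded below at one point. -/
theorem exists_circleAverage_posLog_iteratedDeriv_div_le (k : ℕ) {s r₀ c : ℝ} (hs : s < r₀)
    (hr₀ : 1 / 2 ≤ r₀) (hc : 0 < c) :
    ∃ A : ℝ, ∀ f : ℂ → ℂ, AnalyticOnNhd ℂ f (ball 0 1) →
      (∃ w ∈ closedBall (0 : ℂ) s, c < ‖f w‖) → ∀ r R : ℝ, r₀ < r → r < R → R < 1 →
      circleAverage (fun z => posLog ‖iteratedDeriv k f z / f z‖) 0 r
        ≤ A + 2 * k * posLog (circleAverage (fun z => posLog ‖f z‖) 0 R)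
          + 4 * k * log (1 / (R - r)) := by
  set κ := r₀ - s with hκ
  have hκ0 : 0 < κ := sub_pos.2 hs
  -- 14 = 6 + 8: 6 from `H`, 8 from the zero count with r^(-1/2) ≤ 2; the summand 2 comes from 2/t.
  set K := 14 * (8 / κ * (2 / κ + |log c|)) + 2 with hK
  have hK0 : 0 < K := by positivity
  refine ⟨log (k.factorial * exp 1) + 2 * k * (log K + 3 * log 2), ?_⟩
  rintro f hf ⟨w, hw, hcw⟩ r R hr hrR hR
  rw [mem_closedBall_zero_iff] at hw
  have hr0 : 0 < r := by linarith
  have hR0 : 0 < R := by linarith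
  set T := circleAverage (fun z => posLog ‖f z‖) 0 R with hT
  have hT0 : 0 ≤ T := circleAverage_nonneg_of_nonneg fun z _ => posLog_nonneg
  -- Zeros in |z| ≤ ρ are counted from the radius R, and the growth estimate runs between r and ρ;
  -- both gaps equal t.
  set ρ := (r + R) / 2 with hρ
  set t := (R - r) / 2 with ht
  have ht0 : 0 < t := by linarith
  have ht1 : t ≤ 1 := by linarith
  have hRρ : R - ρ = t := by rw [hρ, ht]; ring
  have hρr : ρ - r = t := by rw [hρ, ht]; ring
  have hfR : AnalyticOnNhd ℂ f (closedBall 0 R) := hf.mono (closedBall_subset_ball hR)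
  have hfρ : AnalyticOnNhd ℂ f (closedBall 0 ρ) :=
    hfR.mono (closedBall_subset_closedBall (by linarith))
  have hwR : w ∈ closedBall (0 : ℂ) R := by
    rw [mem_closedBall_zero_iff]
    linarith
  obtain ⟨S, d, g, h⟩ := exists_isZeroFactorization hR0 hfR hwR (norm_pos_iff.1 (hc.trans hcw))
  obtain ⟨g', h'⟩ := h.restrict (ρ := ρ) (by linarith)
  set W := 8 / κ * (2 / κ * T + |log c|) with hW
  have hW0 : 0 ≤ W := by positivity
  have hn := (h.circleAverage_abs_log_le_and_card_le hfR hκ0 (by linarith) hR.le hc hcw.le).2 ρ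
    (by linarith)
  have hQ := (h'.circleAverage_abs_log_le_and_card_le hfρ hκ0 (by linarith) (by linarith) hc
    hcw.le).1
  have hmono : circleAverage (fun z => posLog ‖f z‖) 0 ρ ≤ T :=
    circleAverage_posLog_mono (by linarith) (by linarith) hfR
  have hQW : circleAverage (fun z => |log ‖f z‖|) 0 ρ ≤ W := hQ.trans (by rw [hW]; gcongr)
  rw [hRρ] at hn
  set nn := ∑ a ∈ S with ‖a‖ ≤ ρ, (d a : ℝ) with hnn
  have hnW : nn ≤ W / t := by
    rw [le_div_iff₀ ht0, mul_comm]
    exact hn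
  have hnn0 : 0 ≤ nn := Finset.sum_nonneg fun a _ => Nat.cast_nonneg _
  set H := 6 * W / t ^ 2 + 2 / t with hH
  have hH1 : 1 ≤ H := by
    have h1 : 1 ≤ 2 / t := by
      rw [le_div_iff₀ ht0]
      linarith
    have h2 : 0 ≤ 6 * W / t ^ 2 := by positivity
    linarith
  have hHle : 2 * nn / (ρ - r) + 4 * circleAverage (fun ζ => |log ‖f ζ‖|) 0 ρ / (ρ - r) ^ 2
      + 2 / (ρ - r) ≤ H := by
    rw [hρr]
    calc 2 * nn / t + 4 * circleAverage (fun ζ => |log ‖f ζ‖|) 0 ρ / t ^ 2 + 2 / t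
        ≤ 2 * (W / t) / t + 4 * W / t ^ 2 + 2 / t := by gcongr
      _ = H := by
        rw [hH]
        field_simp
        ring
  have hmain := h'.circleAverage_posLog_iteratedDeriv_div_le hfρ (by linarith) hr0 (by linarith)
    hH1 hHle k
  have hrp : r ^ (-(1 / 2) : ℝ) ≤ 2 := by
    calc r ^ (-(1 / 2) : ℝ) ≤ (1 / 2 : ℝ) ^ (-(1 / 2) : ℝ) :=
          rpow_le_rpow_of_nonpos (by norm_num) (by linarith) (by norm_num)
      _ ≤ (1 / 2 : ℝ) ^ (-1 : ℝ) :=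
          rpow_le_rpow_of_exponent_ge (by norm_num) (by norm_num) (by norm_num)
      _ = 2 := by
          rw [rpow_neg_one]
          norm_num
  have hM : H + 4 * r ^ (-(1 / 2) : ℝ) * nn ≤ K * (1 + T) * (1 / t ^ 2) := by
    have h1 : 2 / t ≤ 2 / t ^ 2 := by
      gcongr
      nlinarith
    have h2 : W / t ≤ W / t ^ 2 := by
      gcongr
      nlinarith
    have h3 : 4 * r ^ (-(1 / 2) : ℝ) * nn ≤ 4 * 2 * (W / t ^ 2) := by
      gcongr
      exact hnW.trans h2
    have h4 : 14 * W + 2 ≤ K * (1 + T) := by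
      have h5 : W ≤ 8 / κ * (2 / κ + |log c|) * (1 + T) := by
        rw [hW, mul_assoc]
        gcongr
        have : 0 ≤ |log c| * T := by positivity
        have : 0 ≤ 2 / κ := by positivity
        linarith
      rw [hK, add_mul]
      linarith
    calc H + 4 * r ^ (-(1 / 2) : ℝ) * nn ≤ 6 * W / t ^ 2 + 2 / t ^ 2 + 4 * 2 * (W / t ^ 2) := by
          linarith
      _ = (14 * W + 2) * (1 / t ^ 2) := by ring
      _ ≤ _ := by gcongr
  have hlogM : log (H + 4 * r ^ (-(1 / 2) : ℝ) * nn)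
      ≤ log K + 3 * log 2 + posLog T + 2 * log (1 / (R - r)) := by
    refine (log_le_log (by positivity) hM).trans ?_
    have h1 : log (1 + T) ≤ log 2 + posLog T := by
      have := posLog_add (x := 1) (y := T)
      rw [posLog_one, add_zero] at this
      exact (le_max_right _ _).trans this
    have hRr : 0 < R - r := sub_pos.2 hrR
    rw [log_mul (by positivity) (by positivity), log_mul hK0.ne' (by positivity), one_div,
      log_inv, log_pow, ht, log_div hRr.ne' two_ne_zero, one_div, log_inv]
    push_cast
    linarith
  have hk : 2 * (k : ℝ) * log (H + 4 * r ^ (-(1 / 2) : ℝ) * nn)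
      ≤ 2 * k * (log K + 3 * log 2 + posLog T + 2 * log (1 / (R - r))) := by gcongr
  linarith

/-- f⁽ᵏ⁾ = (f⁽ᵏ⁾/f) f off the finitely many zeros, which the mean ignores. -/
theorem circleAverage_posLog_iteratedDeriv_le {f : ℂ → ℂ} {r : ℝ} (hr : 0 < r)
    (hf : AnalyticOnNhd ℂ f (closedBall 0 r)) {w : ℂ} (hw : w ∈ closedBall (0 : ℂ) r)
    (hfw : f w ≠ 0) (k : ℕ) :
    circleAverage (fun z => posLog ‖iteratedDeriv k f z‖) 0 r
      ≤ circleAverage (fun z => posLog ‖iteratedDeriv k f z / f z‖) 0 r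
        + circleAverage (fun z => posLog ‖f z‖) 0 r := by
  obtain ⟨s, d, g, h⟩ := exists_isZeroFactorization hr hf hw hfw
  have hq := circleIntegrable_posLog_iteratedDeriv_div hr.le hf k
  have hp := circleIntegrable_posLog hr.le hf
  have hmer : MeromorphicOn (fun z => iteratedDeriv k f z / f z * f z) (sphere 0 |r|) := by
    rw [abs_of_pos hr]
    have hf' := hf.mono (sphere_subset_closedBall (x := (0 : ℂ)) (ε := r))
    exact ((analyticOnNhd_iteratedDeriv hf' k).meromorphicOn.div hf'.meromorphicOn).mul
      hf'.meromorphicOn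
  have hcongr : circleAverage (fun z => posLog ‖iteratedDeriv k f z‖) 0 r
      = circleAverage (fun z => posLog ‖iteratedDeriv k f z / f z * f z‖) 0 r := by
    refine circleAverage_congr_codiscreteWithin ?_ hr.ne'
    filter_upwards [compl_finite_mem_codiscreteWithin s.finite_toSet,
      self_mem_codiscreteWithin _] with z hz hzs
    rw [abs_of_pos hr] at hzs
    have hfz : f z ≠ 0 := by
      rw [Ne, h.apply_eq_zero_iff (sphere_subset_closedBall hzs)]
      rintro ⟨a, ha, rfl, -⟩
      exact hz ha
    rw [div_mul_cancel₀ _ hfz]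
  rw [hcongr, ← circleAverage_fun_add hq hp]
  refine circleAverage_mono hmer.circleIntegrable_posLog_norm (hq.add hp) fun z _ => ?_
  rw [norm_mul]
  exact posLog_mul

end

end NormalFamilies

/-! ### Both assertions for the subfamily -/

theorem mainTheorem7 (F : Set (ℂ → ℂ))
    (hF : ∀ f ∈ F, DifferentiableOn ℂ f (Metric.ball 0 1))
    (hFnn : ¬ NormalFamilies.IsNormalFamilyOn F (Metric.ball 0 1))
    (k : ℕ) (hk : 1 ≤ k) :
    ∃ r₀ : ℝ, 0 < r₀ ∧ r₀ < 1 ∧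
      ∀ ρ : ℝ, r₀ < ρ → ρ < 1 →
        ∃ F₁ : Set (ℂ → ℂ), F₁ ⊆ F ∧
          NormalFamilies.InfiniteFamilyOn F₁ (Metric.ball 0 1) ∧
          (∀ f ∈ F₁, ∃ z ∈ Metric.ball (0 : ℂ) 1, f z ≠ 0) ∧
          (∃ A B C : ℝ, ∀ f ∈ F₁, ∀ r R : ℝ, r₀ < r → r < R → R < ρ →
            NormalFamilies.m r (fun z => iteratedDeriv k f z / f z) <
              A + B * Real.posLog (NormalFamilies.T R f) + C * Real.log (1 / (R - r))) ∧
          (∃ A B C : ℝ, ∀ f ∈ F₁, ∀ r R : ℝ, r₀ < r → r < R → R < ρ →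
            NormalFamilies.T r (iteratedDeriv k f) ≤
              A + B * NormalFamilies.T R f + C * Real.log (1 / (R - r))) := by
  open Metric Real NormalFamilies in
  obtain ⟨s, c, hs0, hs1, hc, hinf⟩ := exists_infinite_subfamily_of_not_normal hFnn
  have hsr : s < (1 + s) / 2 := by linarith
  obtain ⟨A, hA⟩ := exists_circleAverage_posLog_iteratedDeriv_div_le k hsr (by linarith) hc
  -- The same subfamily serves every ρ.
  refine ⟨(1 + s) / 2, by linarith, by linarith, fun ρ hρ hρ1 =>
    ⟨{f ∈ F | ∃ z ∈ closedBall (0 : ℂ) s, c < ‖f z‖}, Set.sep_subset _ _, hinf, ?_, ?_, ?_⟩⟩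
  · rintro f ⟨-, z, hz, hcz⟩
    exact ⟨z, closedBall_subset_ball hs1 hz, norm_pos_iff.1 (hc.trans hcz)⟩
  -- The 1 makes the inequality strict.
  · refine ⟨A + 1, 2 * k, 4 * k, ?_⟩
    rintro f ⟨hfF, hfc⟩ r R hr hrR hR
    have hf := (hF f hfF).analyticOnNhd isOpen_ball
    have h := hA f hf hfc r R hr hrR (hR.trans hρ1)
    rw [m, ValueDistribution.proximity_top, T_eq_circleAverage (by linarith)
      (hf.mono (closedBall_subset_ball (hR.trans hρ1)))]
    linarith
  · refine ⟨A, 2 * k + 1, 4 * k, ?_⟩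
    rintro f ⟨hfF, z, hz, hcz⟩ r R hr hrR hR
    have hf := (hF f hfF).analyticOnNhd isOpen_ball
    have hfR := hf.mono (closedBall_subset_ball (hR.trans hρ1))
    have hfr := hfR.mono (closedBall_subset_closedBall hrR.le)
    have hr0 : 0 < r := by linarith
    have h := hA f hf ⟨z, hz, hcz⟩ r R hr hrR (hR.trans hρ1)
    have h2 := circleAverage_posLog_iteratedDeriv_le hr0 hfr
      (closedBall_subset_closedBall (by linarith) hz) (norm_pos_iff.1 (hc.trans hcz)) k
    have h3 := circleAverage_posLog_mono hr0 hrR hfR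
    rw [T_eq_circleAverage hr0.le (analyticOnNhd_iteratedDeriv hfr k),
      T_eq_circleAverage (hr0.trans hrR).le hfR]
    set T := circleAverage (fun z => posLog ‖f z‖) 0 R
    have hT0 : 0 ≤ T := circleAverage_nonneg_of_nonneg fun z _ => posLog_nonneg
    have h4 : posLog T ≤ T := max_le hT0 (log_le_self hT0)
    have h5 : 2 * (k : ℝ) * posLog T ≤ 2 * k * T := by gcongr
    linarith
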